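/- Diagrams. Let $k,l\ge 0$. A diagram of a $4$-valent tangle is a projection picture in the strip $\mathbb R\times[0,1]$, with $k$ endpoints on $\mathbb R\times\{0\}$ and $l$ endpoints on $\mathbb R\times\{1\}$, whose double points are crossings (with over/under information) or $4$-valent vertices. Diagrams are considered in general position with respect to the height, that is, as vertical stackings of horizontal slices, each of which contains exactly one local minimum, local maximum, crossing or vertex (crossings and vertices having two edges below and two above). A diagram without vertices is a diagram of an ordinary tangle. Two diagrams with the same endpoints represent the same $4$-valent tangle up to ambient isotopy if and only if they are related by a finite sequence of planar isotopies of the strip fixing its boundary, the Reidemeister moves R1, R2, R3, and the moves N4 (a strand slides over or under a $4$-valent vertex) and N5 (a crossing, of either sign, between two neighbouring edges next to a vertex is inserted or removed); ambient isotopy of $4$-valent tangles is understood in this sense. States. Let $T_-,T_+$ be the two crossings on two strands, $T_0$ the diagram of two vertical arcs, and $T_\infty$ the diagram consisting of an arc that joins the two lower ends and an arc that joins the two upper ends. For a diagram $D$ with vertex set $V(D)$ and a function $f\colon V(D)\to\{T_-,T_+,T_0,T_\infty\}$, the state $(D,f)$ is the ordinary tangle diagram obtained from $D$ by replacing each vertex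 $v$ by $f(v)$, and $\mathcal C(D)$ is the collection of all states of $D$. $3$-equivalence. Two ordinary tangles are $3$-equivalent if their diagrams are related by a finite sequence of planar isotopies, the moves R1, R2, R3, and $3$-moves (insertion or removal of three half twists of the same sign on two parallel strands). For two collections $S_1,S_2$ of tangles, $S_1$ is $3$-equivalent to $S_2$ if every member of $S_1$ is $3$-equivalent to some member of $S_2$. Proposition. Let $D$ and $D'$ be two diagrams of the same $4$-valent tangle (up to ambient isotopy), and let $D$ have $n$ vertices. Then $D'$ has $n$ vertices as well, both $D$ and $D'$ have exactly $4^n$ assignments, and for all enumerations $f_1,\dots,f_{4^n}$ of the assignments of $D$ and $f'_1,\dots,f'_{4^n}$ of the assignments of $D'$ there is a permutation $\sigma$ of $\{1,\dots,4^n\}$ such that the tangle $(D,f_i)$ is $3$-equivalent to the tangle $(D',f'_{\sigma(i)})$ for every $1\le i\le 4^n$. In particular, $\mathcal C(D)$ is $3$-equivalent to $\mathcal C(D')$ and $\mathcal C(D')$ is $3$-equivalent to $\mathcal C(D)$; that is, the $3$-equivalence class of the collection of states is an ambient isotopy invariant of the $4$-valent tangle. -/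

import Mathlib

namespace SpatialGraph

/-- The elementary pieces of a diagram in the strip `ℝ × [0,1]`, read from bottom to top; `V` is
the type of kinds of `4`-valent vertices that are allowed (`Empty` for ordinary tangle diagrams,
`Unit` for diagrams of `4`-valent tangles).
* `cup`: a local minimum, which creates two adjacent strands;
* `cap`: a local maximum, which joins two adjacent strands;
* `cross s`: two adjacent strands cross. The strand that runs from the bottom left to the top
  right is the over-strand if `s = true` and the under-strand if `s = false`;
* `vertex v`: two adjacent strands meet in a `4`-valent vertex, two edges leaving it downwards and
  two upwards. -/
inductive Event (V : Type) : Type where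
  | cup : Event V
  | cap : Event V
  | cross (s : Bool) : Event V
  | vertex (v : V) : Event V

/-- The number of strands that enter an event from below. -/
def Event.inputs {V : Type} : Event V → ℕ
  | .cup => 0
  | .cap => 2
  | .cross _ => 2
  | .vertex _ => 2

/-- The number of strands that leave an event upwards. -/
def Event.outputs {V : Type} : Event V → ℕ
  | .cup => 2
  | .cap => 0
  | .cross _ => 2
  | .vertex _ => 2

/-- A horizontal slice of a diagram that contains exactly one event. There are `pos` vertical
strands to the left of the event; all strands to the right of it are vertical too. -/
structure Slice (V : Type) : Type where
  pos : ℕ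
  event : Event V

/-- `IsWord m w n`: the slices of `w`, stacked from bottom to top, fit on each other and lead from
`m` strands at the bottom to `n` strands at the top. -/
def IsWord {V : Type} : ℕ → List (Slice V) → ℕ → Prop
  | m, [], n => m = n
  | m, s :: w, n =>
      s.pos + s.event.inputs ≤ m ∧ IsWord (m - s.event.inputs + s.event.outputs) w n

/-- A diagram in the strip `ℝ × [0,1]` with `m` endpoints on the lower and `n` endpoints on the
upper boundary line, in general position with respect to the height: its local extrema, crossings
and vertices lie at different heights, and each crossing or vertex has two edges below and two
edges above it. It is given by the list of its slices from bottom to top. -/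
structure Diagram (V : Type) (m n : ℕ) : Type where
  word : List (Slice V)
  isWord : IsWord m word n

/-- Diagrams of `4`-valent tangles (of knotted `4`-valent graphs if `m = n = 0`). -/
abbrev FourValentDiagram (m n : ℕ) : Type := Diagram Unit m n

/-- Diagrams of ordinary tangles: there are no vertices. -/
abbrev TangleDiagram (m n : ℕ) : Type := Diagram Empty m n

/-- The local changes that generate planar isotopy (relative to the boundary of the strip). -/
inductive PlanarMove (V : Type) : List (Slice V) → List (Slice V) → Prop
  /-- Two events that lie side by side exchange their heights; `e` is on the left of `f`, with `k`
  vertical strands between them. -/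
  | exchange (i k : ℕ) (e f : Event V) :
      PlanarMove V [⟨i, e⟩, ⟨i + e.outputs + k, f⟩] [⟨i + e.inputs + k, f⟩, ⟨i, e⟩]
  /-- A local minimum and a local maximum on a strand cancel. -/
  | zigzag (i : ℕ) : PlanarMove V [⟨i, .cup⟩, ⟨i + 1, .cap⟩] []
  /-- The mirror image of the previous change. -/
  | zigzag' (i : ℕ) : PlanarMove V [⟨i + 1, .cup⟩, ⟨i, .cap⟩] []
  /-- A crossing is turned by a right angle. -/
  | turnCross (s : Bool) (i : ℕ) :
      PlanarMove V [⟨i + 2, .cup⟩, ⟨i + 1, .cross s⟩, ⟨i, .cap⟩] [⟨i, .cross !s⟩]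
  /-- A vertex is turned by a right angle. -/
  | turnVertex (v : V) (i : ℕ) :
      PlanarMove V [⟨i + 2, .cup⟩, ⟨i + 1, .vertex v⟩, ⟨i, .cap⟩] [⟨i, .vertex v⟩]

/-- The Reidemeister moves R1, R2 and R3. -/
inductive ReidemeisterMove (V : Type) : List (Slice V) → List (Slice V) → Prop
  | R1_cap (s : Bool) (i : ℕ) : ReidemeisterMove V [⟨i, .cross s⟩, ⟨i, .cap⟩] [⟨i, .cap⟩]
  | R1_cup (s : Bool) (i : ℕ) : ReidemeisterMove V [⟨i, .cup⟩, ⟨i, .cross s⟩] [⟨i, .cup⟩]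
  | R2 (s : Bool) (i : ℕ) : ReidemeisterMove V [⟨i, .cross s⟩, ⟨i, .cross !s⟩] []
  | R3 (s : Bool) (i : ℕ) :
      ReidemeisterMove V [⟨i, .cross s⟩, ⟨i + 1, .cross s⟩, ⟨i, .cross s⟩]
        [⟨i + 1, .cross s⟩, ⟨i, .cross s⟩, ⟨i + 1, .cross s⟩]

/-- The moves at a vertex. -/
inductive VertexMove (V : Type) : List (Slice V) → List (Slice V) → Prop
  /-- A strand slides over (`s = true`) or under (`s = false`) a vertex. -/
  | N4 (v : V) (s : Bool) (i : ℕ) :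
      VertexMove V [⟨i + 1, .vertex v⟩, ⟨i, .cross s⟩, ⟨i + 1, .cross s⟩]
        [⟨i, .cross s⟩, ⟨i + 1, .cross s⟩, ⟨i, .vertex v⟩]
  /-- A crossing of two neighbouring edges next to the vertex is removed. -/
  | N5 (v : V) (s : Bool) (i : ℕ) :
      VertexMove V [⟨i, .vertex v⟩, ⟨i, .cross s⟩] [⟨i, .vertex v⟩]

/-- The `3`-moves: three half twists of the same sign on two parallel strands are removed. -/
inductive ThreeMove (V : Type) : List (Slice V) → List (Slice V) → Prop
  | three (s : Bool) (i : ℕ) :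
      ThreeMove V [⟨i, .cross s⟩, ⟨i, .cross s⟩, ⟨i, .cross s⟩] []

/-- `D'` arises from `D` by one local change from the list `r`; the rest of the diagram is kept. -/
def LocalChange {V : Type} {m n : ℕ} (r : List (Slice V) → List (Slice V) → Prop)
    (D D' : Diagram V m n) : Prop :=
  ∃ u a b v : List (Slice V), r a b ∧ D.word = u ++ a ++ v ∧ D'.word = u ++ b ++ v

/-- Two diagrams represent ambient isotopic `4`-valent tangles (with the same endpoints): they are
related by a finite sequence of planar isotopies, the moves R1, R2, R3, and the moves N4, N5, each
used in either direction. -/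
def AmbientIsotopic {m n : ℕ} (D D' : FourValentDiagram m n) : Prop :=
  Relation.EqvGen
    (LocalChange fun a b => PlanarMove Unit a b ∨ ReidemeisterMove Unit a b ∨ VertexMove Unit a b)
    D D'

/-- `3`-equivalence of ordinary tangle diagrams: they are related by a finite sequence of planar
isotopies, the moves R1, R2, R3, and `3`-moves, each used in either direction. -/
def ThreeEquivalent {m n : ℕ} (T T' : TangleDiagram m n) : Prop :=
  Relation.EqvGen
    (LocalChange fun a b => PlanarMove Empty a b ∨ ReidemeisterMove Empty a b ∨ ThreeMove Empty a b)
    T T'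

/-- The four tangles that may replace a vertex. -/
inductive Replacement : Type where
  | Tminus : Replacement
  | Tplus : Replacement
  | Tzero : Replacement
  | Tinfty : Replacement

/-- The `(2,2)`-tangle diagrams `T₋`, `T₊` (the two crossings), `T₀` (two vertical arcs) and
`T_∞` (an arc that joins the two lower ends and an arc that joins the two upper ends), placed
with `i` strands to their left. -/
def Replacement.word (i : ℕ) : Replacement → List (Slice Empty)
  | .Tminus => [⟨i, .cross true⟩]
  | .Tplus => [⟨i, .cross false⟩]
  | .Tzero => []
  | .Tinfty => [⟨i, .cap⟩, ⟨i, .cup⟩]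

/-- A slice after the replacement of its vertex, if it has one. -/
def resolveSlice : (s : Slice Unit) → (s.event = .vertex () → Replacement) → List (Slice Empty)
  | ⟨i, .cup⟩, _ => [⟨i, .cup⟩]
  | ⟨i, .cap⟩, _ => [⟨i, .cap⟩]
  | ⟨i, .cross s⟩, _ => [⟨i, .cross s⟩]
  | ⟨i, .vertex ()⟩, g => (g rfl).word i

/-- All vertices are replaced as prescribed by `f`. -/
def resolveWord : (w : List (Slice Unit)) →
    ((p : Fin w.length) → (w.get p).event = .vertex () → Replacement) → List (Slice Empty)
  | [], _ => []
  | s :: w, f => resolveSlice s (f 0) ++ resolveWord w fun p => f p.succ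

theorem isWord_resolveSlice_append (s : Slice Unit) (g : s.event = .vertex () → Replacement)
    (m n : ℕ) (w : List (Slice Empty)) (hs : s.pos + s.event.inputs ≤ m)
    (hw : IsWord (m - s.event.inputs + s.event.outputs) w n) :
    IsWord m (resolveSlice s g ++ w) n := by
  obtain ⟨i, e⟩ := s
  cases e with
  | cup => exact ⟨hs, hw⟩
  | cap => exact ⟨hs, hw⟩
  | cross s => exact ⟨hs, hw⟩
  | vertex v =>
    simp only [Event.inputs, Event.outputs] at hs hw
    have h2 : m - 2 + 2 = m := by omega
    simp only [resolveSlice]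
    cases g rfl with
    | Tminus => exact ⟨hs, hw⟩
    | Tplus => exact ⟨hs, hw⟩
    | Tzero => rw [h2] at hw; exact hw
    | Tinfty =>
      refine ⟨hs, ?_, hw⟩
      simp only [Event.inputs, Event.outputs]
      omega

theorem isWord_resolveWord (n : ℕ) : ∀ (w : List (Slice Unit)) (m : ℕ)
    (f : (p : Fin w.length) → (w.get p).event = .vertex () → Replacement),
    IsWord m w n → IsWord m (resolveWord w f) n
  | [], _, _, h => h
  | s :: w, m, f, h =>
    isWord_resolveSlice_append s (f 0) m n _ h.1 (isWord_resolveWord n w _ (fun p => f p.succ) h.2)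

/-- The set of `4`-valent vertices of a diagram. -/
def Diagram.Vertex {m n : ℕ} (D : FourValentDiagram m n) : Type :=
  {p : Fin D.word.length // (D.word.get p).event = .vertex ()}

/-- The assignments of one of `T₋`, `T₊`, `T₀`, `T_∞` to each vertex of `D`. -/
abbrev Diagram.Assignment {m n : ℕ} (D : FourValentDiagram m n) : Type :=
  D.Vertex → Replacement

/-- The state `(D, f)`. -/
def Diagram.state {m n : ℕ} (D : FourValentDiagram m n) (f : D.Assignment) : TangleDiagram m n where
  word := resolveWord D.word fun p hp => f ⟨p, hp⟩
  isWord := isWord_resolveWord n D.word m _ D.isWord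

/-- The collection of all states of `D`. -/
def Diagram.stateCollection {m n : ℕ} (D : FourValentDiagram m n) : Set (TangleDiagram m n) :=
  Set.range D.state

/-- Every member of `S₁` is `3`-equivalent to some member of `S₂`. -/
def CollectionThreeEquivalent {m n : ℕ} (S₁ S₂ : Set (TangleDiagram m n)) : Prop :=
  ∀ T₁ ∈ S₁, ∃ T₂ ∈ S₂, ThreeEquivalent T₁ T₂

end SpatialGraph

namespace SpatialGraph

/-! Every local move that generates ambient isotopy lifts to a bijection between the assignments
before and after it, under which corresponding states are `3`-equivalent. Vertices outside the move
keep their replacements. Inside it, an exchange of heights and N4 also keep them: N4 becomes R3 if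
the replacement is a crossing, and a slide past a maximum and a minimum if it is `Tinfty`. A quarter
turn of a vertex acts by `Replacement.turn`, which swaps the two crossings and swaps `Tzero` with
`Tinfty`. For N5 the extra half twist acts by `Replacement.twist`: it fixes `Tinfty` by R1 and
permutes the other three cyclically, because two half twists equal the opposite half twist modulo a
`3`-move. The carrying lemmas are `IsBlock.exchange`, `wordEquiv_slide_replacement`,
`wordEquiv_turn_replacement` and `wordEquiv_twist_replacement`. `HasStates` reindexes states by
convenient types, so that the bijections can be written without positions in words. Bijections
compose and invert along a sequence of moves, and counting assignments then gives the number of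
vertices. -/

/-! ### Strand counts of words -/

theorem isWord_append {V : Type} {m n : ℕ} {a b : List (Slice V)} :
    IsWord m (a ++ b) n ↔ ∃ p, IsWord m a p ∧ IsWord p b n := by
  induction a generalizing m with
  | nil => simp [IsWord]
  | cons s a ih => simp [IsWord, ih, and_assoc]

theorem IsWord.append {V : Type} {m p n : ℕ} {a b : List (Slice V)} (ha : IsWord m a p)
    (hb : IsWord p b n) : IsWord m (a ++ b) n :=
  isWord_append.2 ⟨p, ha, hb⟩

/-- A word and the number of strands at its bottom determine the number of strands at its top. -/
theorem IsWord.top_unique {V : Type} {m n n' : ℕ} {w : List (Slice V)} (h : IsWord m w n)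
    (h' : IsWord m w n') : n = n' := by
  induction w generalizing m with
  | nil => exact Eq.trans (Eq.symm h) h'
  | cons s w ih => exact ih h.2 h'.2

/-- A word and the number of strands at its top determine the number of strands at its bottom. -/
theorem IsWord.bottom_unique {V : Type} {m m' n : ℕ} {w : List (Slice V)} (h : IsWord m w n)
    (h' : IsWord m' w n) : m = m' := by
  induction w generalizing m m' with
  | nil => exact Eq.trans h (Eq.symm h')
  | cons s w ih =>
    have := ih h.2 h'.2
    -- The slice conditions make the truncated subtractions exact, so the equation can be solved for
    -- `m`.
    have h1 := h.1
    have h2 := h'.1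
    omega

/-! ### `3`-equivalence of words inside larger words -/

/-- Words that lead from `m` to `n` strands and represent `3`-equivalent tangles. -/
def WordEquiv (m n : ℕ) (a b : List (Slice Empty)) : Prop :=
  ∃ (ha : IsWord m a n) (hb : IsWord m b n),
    ThreeEquivalent (⟨a, ha⟩ : TangleDiagram m n) ⟨b, hb⟩

namespace WordEquiv

variable {m n p : ℕ} {a b c d : List (Slice Empty)}

theorem refl (h : IsWord m a n) : WordEquiv m n a a :=
  ⟨h, h, .refl _⟩

theorem symm (h : WordEquiv m n a b) : WordEquiv m n b a :=
  let ⟨ha, hb, h⟩ := h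
  ⟨hb, ha, .symm _ _ h⟩

theorem trans (h : WordEquiv m n a b) (h' : WordEquiv m n b c) : WordEquiv m n a c :=
  let ⟨ha, _, h⟩ := h
  let ⟨_, hc, h'⟩ := h'
  ⟨ha, hc, .trans _ _ _ h h'⟩

theorem of_move (u v : List (Slice Empty))
    (h : PlanarMove Empty a b ∨ ReidemeisterMove Empty a b ∨ ThreeMove Empty a b)
    (ha : IsWord m (u ++ a ++ v) n) (hb : IsWord m (u ++ b ++ v) n) :
    WordEquiv m n (u ++ a ++ v) (u ++ b ++ v) :=
  ⟨ha, hb, .rel _ _ ⟨u, a, b, v, h, rfl, rfl⟩⟩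

theorem of_planar (u v : List (Slice Empty)) (h : PlanarMove Empty a b)
    (ha : IsWord m (u ++ a ++ v) n) (hb : IsWord m (u ++ b ++ v) n) :
    WordEquiv m n (u ++ a ++ v) (u ++ b ++ v) :=
  of_move u v (.inl h) ha hb

theorem of_reidemeister (u v : List (Slice Empty)) (h : ReidemeisterMove Empty a b)
    (ha : IsWord m (u ++ a ++ v) n) (hb : IsWord m (u ++ b ++ v) n) :
    WordEquiv m n (u ++ a ++ v) (u ++ b ++ v) :=
  of_move u v (.inr (.inl h)) ha hb

/-- A local change of the middle word is a local change of the whole word with a larger surrounding.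
-/
theorem context {q : ℕ} {u v : List (Slice Empty)} (hu : IsWord q u m) (h : WordEquiv m n a b)
    (hv : IsWord n v p) : WordEquiv q p (u ++ a ++ v) (u ++ b ++ v) := by
  obtain ⟨ha, hb, h⟩ := h
  refine ⟨(hu.append ha).append hv, (hu.append hb).append hv, ?_⟩
  -- Induction on `EqvGen` passes through intermediate diagrams, so the claim is stated for
  -- arbitrary diagrams instead of the two given words.
  suffices H : ∀ D D' : TangleDiagram m n, ThreeEquivalent D D' →
      ThreeEquivalent (⟨u ++ D.word ++ v, (hu.append D.isWord).append hv⟩ : TangleDiagram q p)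
        ⟨u ++ D'.word ++ v, (hu.append D'.isWord).append hv⟩ from H _ _ h
  intro D D' h
  induction h with
  | rel D D' h =>
    obtain ⟨u', a, b, v', h, h1, h2⟩ := h
    exact .rel _ _ ⟨u ++ u', a, b, v' ++ v, h, by simp [h1], by simp [h2]⟩
  | refl D => exact .refl _
  | symm D D' _ ih => exact .symm _ _ ih
  | trans D D' D'' _ _ ih ih' => exact .trans _ _ _ ih ih'

theorem append_left {q : ℕ} {u : List (Slice Empty)} (hu : IsWord q u m)
    (h : WordEquiv m n a b) : WordEquiv q n (u ++ a) (u ++ b) := by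
  simpa using context (v := []) hu h rfl

theorem append_right {v : List (Slice Empty)} (h : WordEquiv m n a b)
    (hv : IsWord n v p) : WordEquiv m p (a ++ v) (b ++ v) := by
  simpa using context (u := []) rfl h hv

end WordEquiv

/-! ### Exchange of blocks -/

/-- Families of words that act on `p` neighbouring strands and turn them into `q` strands; the
argument of the family is the number of strands on the left. -/
inductive IsBlock : ℕ → ℕ → (ℕ → List (Slice Empty)) → Prop
  | nil (p : ℕ) : IsBlock p p fun _ => []
  | single (e : Event Empty) : IsBlock e.inputs e.outputs fun i => [⟨i, e⟩]
  | append {p q r : ℕ} {P Q : ℕ → List (Slice Empty)} : IsBlock p q P → IsBlock q r Q →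
      IsBlock p r fun i => P i ++ Q i

theorem IsBlock.isWord {p q : ℕ} {P : ℕ → List (Slice Empty)} (h : IsBlock p q P) {i m n : ℕ}
    (hm : i + p ≤ m) (hn : n = m - p + q) : IsWord m (P i) n := by
  induction h generalizing m n with
  | nil p => simp only [IsWord]; omega
  | single e => exact ⟨hm, hn.symm⟩
  | append _ _ ihP ihQ =>
    exact (ihP hm rfl).append (ihQ (by omega) (by omega))

/-- The event `f` passes the factors of the block one at a time; the gap `k` stays constant while
the strand count to its left follows the block. -/
theorem IsBlock.exchange_single {p q : ℕ} {P : ℕ → List (Slice Empty)} (h : IsBlock p q P)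
    (f : Event Empty) {i k m n : ℕ} (hm : i + p + k + f.inputs ≤ m)
    (hn : n = m - p + q - f.inputs + f.outputs) :
    WordEquiv m n (P i ++ [⟨i + q + k, f⟩]) ([⟨i + p + k, f⟩] ++ P i) := by
  induction h generalizing m n with
  | nil p =>
    refine .refl ?_
    simp only [IsWord, List.nil_append]
    omega
  | single e =>
    simpa using WordEquiv.of_planar [] [] (.exchange i k e f)
      (by simp [IsWord]; omega) (by simp [IsWord]; omega)
  | @append p q r P Q hP hQ ihP ihQ =>
    -- Going down, `f` meets the upper factor `Q` before the lower factor `P`.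
    have h1 := WordEquiv.append_left (hP.isWord (i := i) (m := m) (by omega) rfl)
      (ihQ (m := m - p + q) (n := n) (by omega) (by omega))
    have h2 := WordEquiv.append_right
      (ihP (m := m) (n := m - p + q - f.inputs + f.outputs) (by omega) rfl)
      (hQ.isWord (i := i) (n := n) (by omega) (by omega))
    simp only [List.append_assoc] at h1 h2 ⊢
    exact h1.trans h2

/-- Two blocks that lie side by side exchange their heights. -/
theorem IsBlock.exchange {p q r s : ℕ} {P Q : ℕ → List (Slice Empty)} (hP : IsBlock p q P)
    (hQ : IsBlock r s Q) {i k m n : ℕ} (hm : i + p + k + r ≤ m)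
    (hn : n = m - p + q - r + s) :
    WordEquiv m n (P i ++ Q (i + q + k)) (Q (i + p + k) ++ P i) := by
  induction hQ generalizing m n with
  | nil r =>
    simpa using WordEquiv.refl (hP.isWord (i := i) (m := m) (n := n) (by omega) (by omega))
  | single f => exact hP.exchange_single f hm hn
  | @append r s t Q R hQ hR ihQ ihR =>
    have h1 := WordEquiv.append_right
      (ihQ (m := m) (n := m - p + q - r + s) (by omega) rfl)
      (hR.isWord (i := i + q + k) (n := n) (by omega) (by omega))
    have h2 := WordEquiv.append_left (hQ.isWord (i := i + p + k) (m := m) (by omega) rfl)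
      (ihR (m := m - r + s) (n := n) (by omega) (by omega))
    simp only [List.append_assoc] at h1 h2 ⊢
    exact h1.trans h2

/-- A replaced vertex may consist of no slice (`Tzero`) or two (`Tinfty`), so exchanging heights
with it needs blocks and not only single events. -/
theorem Replacement.isBlock (r : Replacement) : IsBlock 2 2 fun i => r.word i := by
  cases r with
  | Tminus => exact .single (.cross true)
  | Tplus => exact .single (.cross false)
  | Tzero => exact .nil 2
  | Tinfty => exact .append (.single .cap) (.single .cup)

/-! ### Consequences of planar isotopy and the Reidemeister moves -/

section Slides

variable {i m n : ℕ} (s : Bool)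

/-- A crossing is turned by a right angle, in the other direction. -/
theorem wordEquiv_turnCross' (hm : i + 2 ≤ m) :
    WordEquiv m m [⟨i, .cup⟩, ⟨i + 1, .cross s⟩, ⟨i + 2, .cap⟩] [⟨i, .cross !s⟩] := by
  -- The inner crossing is written as a turn of the opposite crossing. Each outer extremum then
  -- cancels with one of the two new ones.
  have h1 : WordEquiv m m
      [⟨i, .cup⟩, ⟨i + 3, .cup⟩, ⟨i + 2, .cross !s⟩, ⟨i + 1, .cap⟩, ⟨i + 2, .cap⟩]
      [⟨i, .cup⟩, ⟨i + 1, .cross s⟩, ⟨i + 2, .cap⟩] := by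
    simpa using WordEquiv.of_planar [⟨i, .cup⟩] [⟨i + 2, .cap⟩] (.turnCross (!s) (i + 1))
      (by simp [IsWord, Event.inputs, Event.outputs]; omega)
      (by simp [IsWord, Event.inputs, Event.outputs]; omega)
  have h2 : WordEquiv m m
      [⟨i, .cup⟩, ⟨i + 3, .cup⟩, ⟨i + 2, .cross !s⟩, ⟨i + 1, .cap⟩, ⟨i + 2, .cap⟩]
      [⟨i + 1, .cup⟩, ⟨i, .cup⟩, ⟨i + 2, .cross !s⟩, ⟨i + 1, .cap⟩, ⟨i + 2, .cap⟩] :=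
    WordEquiv.of_planar [] [⟨i + 2, .cross !s⟩, ⟨i + 1, .cap⟩, ⟨i + 2, .cap⟩]
      (.exchange i 1 .cup .cup)
      (by simp [IsWord, Event.inputs, Event.outputs]; omega)
      (by simp [IsWord, Event.inputs, Event.outputs]; omega)
  have h3 : WordEquiv m m
      [⟨i + 1, .cup⟩, ⟨i, .cup⟩, ⟨i + 2, .cross !s⟩, ⟨i + 1, .cap⟩, ⟨i + 2, .cap⟩]
      [⟨i + 1, .cup⟩, ⟨i, .cross !s⟩, ⟨i, .cup⟩, ⟨i + 1, .cap⟩, ⟨i + 2, .cap⟩] :=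
    WordEquiv.of_planar [⟨i + 1, .cup⟩] [⟨i + 1, .cap⟩, ⟨i + 2, .cap⟩]
      (.exchange i 0 .cup (.cross !s))
      (by simp [IsWord, Event.inputs, Event.outputs]; omega)
      (by simp [IsWord, Event.inputs, Event.outputs]; omega)
  have h4 : WordEquiv m m
      [⟨i + 1, .cup⟩, ⟨i, .cross !s⟩, ⟨i, .cup⟩, ⟨i + 1, .cap⟩, ⟨i + 2, .cap⟩]
      [⟨i + 1, .cup⟩, ⟨i, .cross !s⟩, ⟨i + 2, .cap⟩] :=
    WordEquiv.of_planar [⟨i + 1, .cup⟩, ⟨i, .cross !s⟩] [⟨i + 2, .cap⟩] (.zigzag i)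
      (by simp [IsWord, Event.inputs, Event.outputs]; omega)
      (by simp [IsWord, Event.inputs, Event.outputs]; omega)
  have h5 : WordEquiv m m
      [⟨i + 1, .cup⟩, ⟨i, .cross !s⟩, ⟨i + 2, .cap⟩]
      [⟨i + 1, .cup⟩, ⟨i + 2, .cap⟩, ⟨i, .cross !s⟩] :=
    WordEquiv.of_planar [⟨i + 1, .cup⟩] [] (.exchange i 0 (.cross !s) .cap)
      (by simp [IsWord, Event.inputs, Event.outputs]; omega)
      (by simp [IsWord, Event.inputs, Event.outputs]; omega)
  have h6 : WordEquiv m m [⟨i + 1, .cup⟩, ⟨i + 2, .cap⟩, ⟨i, .cross !s⟩] [⟨i, .cross !s⟩] :=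
    WordEquiv.of_planar [] [⟨i, .cross !s⟩] (.zigzag (i + 1))
      (by simp [IsWord, Event.inputs, Event.outputs]; omega)
      (by simp [IsWord, Event.inputs, Event.outputs]; omega)
  exact h1.symm.trans (h2.trans (h3.trans (h4.trans (h5.trans h6))))

/-- A local minimum moves across a strand. -/
theorem wordEquiv_cup_cross (hm : i + 1 ≤ m) :
    WordEquiv m (m + 2) [⟨i + 1, .cup⟩, ⟨i, .cross s⟩] [⟨i, .cup⟩, ⟨i + 1, .cross !s⟩] := by
  -- In its turned form the crossing carries a maximum, which cancels with the given minimum.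
  have h1 : WordEquiv m (m + 2)
      [⟨i + 1, .cup⟩, ⟨i, .cup⟩, ⟨i + 1, .cross !s⟩, ⟨i + 2, .cap⟩]
      [⟨i + 1, .cup⟩, ⟨i, .cross s⟩] := by
    simpa using WordEquiv.append_left (u := [⟨i + 1, .cup⟩]) (q := m)
      (by simp [IsWord, Event.inputs, Event.outputs]; omega)
      (wordEquiv_turnCross' (i := i) (m := m + 2) (!s) (by omega))
  have h2 : WordEquiv m (m + 2)
      [⟨i, .cup⟩, ⟨i + 3, .cup⟩, ⟨i + 1, .cross !s⟩, ⟨i + 2, .cap⟩]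
      [⟨i + 1, .cup⟩, ⟨i, .cup⟩, ⟨i + 1, .cross !s⟩, ⟨i + 2, .cap⟩] :=
    WordEquiv.of_planar [] [⟨i + 1, .cross !s⟩, ⟨i + 2, .cap⟩] (.exchange i 1 .cup .cup)
      (by simp [IsWord, Event.inputs, Event.outputs]; omega)
      (by simp [IsWord, Event.inputs, Event.outputs]; omega)
  have h3 : WordEquiv m (m + 2)
      [⟨i, .cup⟩, ⟨i + 1, .cross !s⟩, ⟨i + 3, .cup⟩, ⟨i + 2, .cap⟩]
      [⟨i, .cup⟩, ⟨i + 3, .cup⟩, ⟨i + 1, .cross !s⟩, ⟨i + 2, .cap⟩] :=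
    WordEquiv.of_planar [⟨i, .cup⟩] [⟨i + 2, .cap⟩] (.exchange (i + 1) 0 (.cross !s) .cup)
      (by simp [IsWord, Event.inputs, Event.outputs]; omega)
      (by simp [IsWord, Event.inputs, Event.outputs]; omega)
  have h4 : WordEquiv m (m + 2)
      [⟨i, .cup⟩, ⟨i + 1, .cross !s⟩, ⟨i + 3, .cup⟩, ⟨i + 2, .cap⟩]
      [⟨i, .cup⟩, ⟨i + 1, .cross !s⟩] :=
    WordEquiv.of_planar [⟨i, .cup⟩, ⟨i + 1, .cross !s⟩] [] (.zigzag' (i + 2))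
      (by simp [IsWord, Event.inputs, Event.outputs]; omega)
      (by simp [IsWord, Event.inputs, Event.outputs]; omega)
  exact h1.symm.trans (h2.symm.trans (h3.symm.trans h4))

/-- A local maximum moves across a strand. -/
theorem wordEquiv_cross_cap (hm : i + 3 ≤ m) :
    WordEquiv m (m - 2) [⟨i + 1, .cross s⟩, ⟨i, .cap⟩] [⟨i, .cross !s⟩, ⟨i + 1, .cap⟩] := by
  -- The turned form of the crossing on the right-hand side carries a minimum, which cancels with
  -- the maximum at `i + 1`.
  have h1 : WordEquiv m (m - 2)
      [⟨i + 2, .cup⟩, ⟨i + 1, .cross s⟩, ⟨i, .cap⟩, ⟨i + 1, .cap⟩]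
      [⟨i, .cross !s⟩, ⟨i + 1, .cap⟩] :=
    WordEquiv.of_planar [] [⟨i + 1, .cap⟩] (.turnCross s i)
      (by simp [IsWord, Event.inputs, Event.outputs]; omega)
      (by simp [IsWord, Event.inputs, Event.outputs]; omega)
  have h2 : WordEquiv m (m - 2)
      [⟨i + 2, .cup⟩, ⟨i + 1, .cross s⟩, ⟨i, .cap⟩, ⟨i + 1, .cap⟩]
      [⟨i + 2, .cup⟩, ⟨i + 1, .cross s⟩, ⟨i + 3, .cap⟩, ⟨i, .cap⟩] :=
    WordEquiv.of_planar [⟨i + 2, .cup⟩, ⟨i + 1, .cross s⟩] [] (.exchange i 1 .cap .cap)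
      (by simp [IsWord, Event.inputs, Event.outputs]; omega)
      (by simp [IsWord, Event.inputs, Event.outputs]; omega)
  have h3 : WordEquiv m (m - 2)
      [⟨i + 2, .cup⟩, ⟨i + 1, .cross s⟩, ⟨i + 3, .cap⟩, ⟨i, .cap⟩]
      [⟨i + 2, .cup⟩, ⟨i + 3, .cap⟩, ⟨i + 1, .cross s⟩, ⟨i, .cap⟩] :=
    WordEquiv.of_planar [⟨i + 2, .cup⟩] [⟨i, .cap⟩] (.exchange (i + 1) 0 (.cross s) .cap)
      (by simp [IsWord, Event.inputs, Event.outputs]; omega)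
      (by simp [IsWord, Event.inputs, Event.outputs]; omega)
  have h4 : WordEquiv m (m - 2)
      [⟨i + 2, .cup⟩, ⟨i + 3, .cap⟩, ⟨i + 1, .cross s⟩, ⟨i, .cap⟩]
      [⟨i + 1, .cross s⟩, ⟨i, .cap⟩] :=
    WordEquiv.of_planar [] [⟨i + 1, .cross s⟩, ⟨i, .cap⟩] (.zigzag (i + 2))
      (by simp [IsWord, Event.inputs, Event.outputs]; omega)
      (by simp [IsWord, Event.inputs, Event.outputs]; omega)
  exact h4.symm.trans (h3.symm.trans (h2.symm.trans h1))

theorem wordEquiv_cross_cancel (hm : i + 2 ≤ m) :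
    WordEquiv m m [⟨i, .cross s⟩, ⟨i, .cross !s⟩] [] :=
  WordEquiv.of_reidemeister [] [] (.R2 s i)
    (by simp [IsWord, Event.inputs, Event.outputs]; omega)
    (by simp [IsWord])

theorem wordEquiv_cross_cancel' (hm : i + 2 ≤ m) :
    WordEquiv m m [⟨i, .cross !s⟩, ⟨i, .cross s⟩] [] := by
  simpa using wordEquiv_cross_cancel (!s) hm

/-- A strand slides over or under a local minimum. -/
theorem wordEquiv_slide_cup (hm : i + 1 ≤ m) :
    WordEquiv m (m + 2) [⟨i + 1, .cup⟩, ⟨i, .cross s⟩, ⟨i + 1, .cross s⟩] [⟨i, .cup⟩] :=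
  ((wordEquiv_cup_cross s hm).append_right (v := [⟨i + 1, .cross s⟩])
    (by simp [IsWord, Event.inputs, Event.outputs]; omega)).trans
  ((wordEquiv_cross_cancel' (i := i + 1) (m := m + 2) s (by omega)).append_left
    (u := [⟨i, .cup⟩]) (by simp [IsWord, Event.inputs, Event.outputs]; omega))

/-- A strand slides over or under a local maximum. -/
theorem wordEquiv_slide_cap (hm : i + 3 ≤ m) :
    WordEquiv m (m - 2) [⟨i, .cross s⟩, ⟨i + 1, .cross s⟩, ⟨i, .cap⟩] [⟨i + 1, .cap⟩] :=
  ((wordEquiv_cross_cap s hm).append_left (u := [⟨i, .cross s⟩]) (q := m)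
    (by simp [IsWord, Event.inputs, Event.outputs]; omega)).trans
  ((wordEquiv_cross_cancel (i := i) (m := m) s (by omega)).append_right
    (v := [⟨i + 1, .cap⟩]) (by simp [IsWord, Event.inputs, Event.outputs]; omega))

theorem wordEquiv_R3 (hm : i + 3 ≤ m) :
    WordEquiv m m [⟨i + 1, .cross s⟩, ⟨i, .cross s⟩, ⟨i + 1, .cross s⟩]
      [⟨i, .cross s⟩, ⟨i + 1, .cross s⟩, ⟨i, .cross s⟩] :=
  (WordEquiv.of_reidemeister [] [] (.R3 s i)
    (by simp [IsWord, Event.inputs, Event.outputs]; omega)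
    (by simp [IsWord, Event.inputs, Event.outputs]; omega)).symm

/-- A strand slides over or under a crossing of the opposite sign. -/
theorem wordEquiv_R3_not (hm : i + 3 ≤ m) :
    WordEquiv m m [⟨i + 1, .cross !s⟩, ⟨i, .cross s⟩, ⟨i + 1, .cross s⟩]
      [⟨i, .cross s⟩, ⟨i + 1, .cross s⟩, ⟨i, .cross !s⟩] := by
  -- A cancelling pair is inserted on top, R3 is applied to the three middle crossings of equal
  -- sign, and a cancelling pair is removed at the bottom.
  have h1 : WordEquiv m m
      [⟨i + 1, .cross !s⟩, ⟨i, .cross s⟩, ⟨i + 1, .cross s⟩, ⟨i, .cross s⟩, ⟨i, .cross !s⟩]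
      [⟨i + 1, .cross !s⟩, ⟨i, .cross s⟩, ⟨i + 1, .cross s⟩] :=
    (wordEquiv_cross_cancel (m := m) s (by omega)).append_left
      (u := [⟨i + 1, .cross !s⟩, ⟨i, .cross s⟩, ⟨i + 1, .cross s⟩])
      (by simp [IsWord, Event.inputs, Event.outputs]; omega)
  have h2 : WordEquiv m m
      [⟨i + 1, .cross !s⟩, ⟨i + 1, .cross s⟩, ⟨i, .cross s⟩, ⟨i + 1, .cross s⟩, ⟨i, .cross !s⟩]
      [⟨i + 1, .cross !s⟩, ⟨i, .cross s⟩, ⟨i + 1, .cross s⟩, ⟨i, .cross s⟩, ⟨i, .cross !s⟩] :=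
    WordEquiv.context (u := [⟨i + 1, .cross !s⟩]) (v := [⟨i, .cross !s⟩])
      (by simp [IsWord, Event.inputs, Event.outputs]; omega) (wordEquiv_R3 (m := m) s hm)
      (by simp [IsWord, Event.inputs, Event.outputs]; omega)
  have h3 : WordEquiv m m
      [⟨i + 1, .cross !s⟩, ⟨i + 1, .cross s⟩, ⟨i, .cross s⟩, ⟨i + 1, .cross s⟩, ⟨i, .cross !s⟩]
      [⟨i, .cross s⟩, ⟨i + 1, .cross s⟩, ⟨i, .cross !s⟩] :=
    (wordEquiv_cross_cancel' (m := m) s (by omega)).append_right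
      (by simp [IsWord, Event.inputs, Event.outputs]; omega)
  exact h1.symm.trans (h2.symm.trans h3)

/-- A strand slides over or under a replaced vertex. -/
theorem wordEquiv_slide_replacement (r : Replacement) (hm : i + 3 ≤ m) :
    WordEquiv m m (r.word (i + 1) ++ [⟨i, .cross s⟩, ⟨i + 1, .cross s⟩])
      ([⟨i, .cross s⟩, ⟨i + 1, .cross s⟩] ++ r.word i) := by
  cases r with
  | Tminus =>
    cases s
    · exact wordEquiv_R3_not false hm
    · exact wordEquiv_R3 true hm
  | Tplus =>
    cases s
    · exact wordEquiv_R3 false hm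
    · exact wordEquiv_R3_not true hm
  | Tzero => exact .refl (by simp [Replacement.word, IsWord, Event.inputs, Event.outputs]; omega)
  | Tinfty =>
    obtain ⟨j, rfl⟩ : ∃ j, m = j + 2 := ⟨m - 2, by omega⟩
    -- The two crossings disappear at the minimum and reappear below the maximum.
    exact ((wordEquiv_slide_cup (i := i) (m := j) s (by omega)).append_left
      (u := [⟨i + 1, .cap⟩]) (q := j + 2)
      (by simp [IsWord, Event.inputs, Event.outputs]; omega)).trans
      ((wordEquiv_slide_cap (i := i) (m := j + 2) s (by omega)).append_right (p := j + 2)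
        (v := [⟨i, .cup⟩]) (by simp [IsWord, Event.inputs, Event.outputs]; omega)).symm

/-- This is the only place where a `3`-move is used. -/
theorem wordEquiv_cross_sq (hm : i + 2 ≤ m) :
    WordEquiv m m [⟨i, .cross s⟩, ⟨i, .cross s⟩] [⟨i, .cross !s⟩] := by
  have h1 : WordEquiv m m [⟨i, .cross s⟩, ⟨i, .cross s⟩, ⟨i, .cross s⟩, ⟨i, .cross !s⟩]
      [⟨i, .cross s⟩, ⟨i, .cross s⟩] :=
    (wordEquiv_cross_cancel (m := m) s hm).append_left (u := [⟨i, .cross s⟩, ⟨i, .cross s⟩])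
      (by simp [IsWord, Event.inputs, Event.outputs]; omega)
  have h2 : WordEquiv m m [⟨i, .cross s⟩, ⟨i, .cross s⟩, ⟨i, .cross s⟩, ⟨i, .cross !s⟩]
      [⟨i, .cross !s⟩] :=
    WordEquiv.of_move [] [⟨i, .cross !s⟩] (.inr (.inr (.three s i)))
      (by simp [IsWord, Event.inputs, Event.outputs]; omega)
      (by simp [IsWord, Event.inputs, Event.outputs]; omega)
  exact h1.symm.trans h2

end Slides

/-! ### Turning and twisting a replaced vertex -/

/-- The effect of a right angle turn on the replacements. -/
def Replacement.turn : Replacement → Replacement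
  | .Tminus => .Tplus
  | .Tplus => .Tminus
  | .Tzero => .Tinfty
  | .Tinfty => .Tzero

theorem Replacement.turn_involutive : Function.Involutive Replacement.turn := by
  intro r
  cases r <;> rfl

/-- The effect of an additional half twist on the replacements, up to `3`-equivalence. -/
def Replacement.twist : Bool → Replacement → Replacement
  | true, .Tminus => .Tplus
  | true, .Tplus => .Tzero
  | true, .Tzero => .Tminus
  | false, .Tminus => .Tzero
  | false, .Tplus => .Tminus
  | false, .Tzero => .Tplus
  | _, .Tinfty => .Tinfty

/-- `twist s` is a `3`-cycle on `Tminus`, `Tplus`, `Tzero`, and the opposite sign gives the inverse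
cycle; this makes N5 a bijection of assignments. -/
theorem Replacement.twist_not_twist (s : Bool) (r : Replacement) :
    Replacement.twist (!s) (Replacement.twist s r) = r := by
  cases s <;> cases r <;> rfl

/-- Planar isotopy suffices: `turnCross` for the crossings, an exchange of the two extrema for
`Tzero`, two zigzags for `Tinfty`. -/
theorem wordEquiv_turn_replacement {i m : ℕ} (r : Replacement) (hm : i + 2 ≤ m) :
    WordEquiv m m ([⟨i + 2, .cup⟩] ++ r.word (i + 1) ++ [⟨i, .cap⟩]) (r.turn.word i) := by
  cases r with
  | Tminus =>
    exact WordEquiv.of_planar [] [] (.turnCross true i)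
      (by simp [IsWord, Event.inputs, Event.outputs]; omega)
      (by simp [IsWord, Event.inputs, Event.outputs]; omega)
  | Tplus =>
    exact WordEquiv.of_planar [] [] (.turnCross false i)
      (by simp [IsWord, Event.inputs, Event.outputs]; omega)
      (by simp [IsWord, Event.inputs, Event.outputs]; omega)
  | Tzero =>
    exact (WordEquiv.of_planar [] [] (.exchange i 0 .cap .cup)
      (by simp [IsWord, Event.inputs, Event.outputs]; omega)
      (by simp [IsWord, Event.inputs, Event.outputs]; omega)).symm
  | Tinfty =>
    exact (WordEquiv.of_planar (m := m) (n := m) [] [⟨i + 1, .cup⟩, ⟨i, .cap⟩] (.zigzag' (i + 1))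
      (by simp [IsWord, Event.inputs, Event.outputs]; omega)
      (by simp [IsWord, Event.inputs, Event.outputs]; omega)).trans
      (WordEquiv.of_planar (m := m) (n := m) [] [] (.zigzag' i)
      (by simp [IsWord, Event.inputs, Event.outputs]; omega)
      (by simp [IsWord]))

/-- On a crossing the half twist cancels by R2 or yields the opposite crossing by a `3`-move; on
`Tinfty` it is a kink at the minimum, removed by R1. -/
theorem wordEquiv_twist_replacement {i m : ℕ} (s : Bool) (r : Replacement) (hm : i + 2 ≤ m) :
    WordEquiv m m (r.word i ++ [⟨i, .cross s⟩]) ((r.twist s).word i) := by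
  cases r with
  | Tminus =>
    cases s
    · exact wordEquiv_cross_cancel' false hm
    · exact wordEquiv_cross_sq true hm
  | Tplus =>
    cases s
    · exact wordEquiv_cross_sq false hm
    · exact wordEquiv_cross_cancel' true hm
  | Tzero =>
    cases s <;> exact .refl (by simp [Replacement.word, IsWord, Event.inputs, Event.outputs]; omega)
  | Tinfty =>
    cases s <;> exact WordEquiv.of_reidemeister [⟨i, .cap⟩] [] (.R1_cup _ i)
      (by simp [IsWord, Event.inputs, Event.outputs]; omega)
      (by simp [IsWord, Event.inputs, Event.outputs]; omega)

/-! ### Families of states -/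

/-- The assignments of replacements to the vertices of a word. -/
abbrev WordAssignment (w : List (Slice Unit)) : Type :=
  (p : Fin w.length) → (w.get p).event = .vertex () → Replacement

/-- The states of `w`, indexed by the assignments, are the family `φ`, up to a bijection between
the index sets. -/
def HasStates (w : List (Slice Unit)) {ι : Type} (φ : ι → List (Slice Empty)) : Prop :=
  ∃ e : WordAssignment w ≃ ι, ∀ f, resolveWord w f = φ (e f)

theorem hasStates_self (w : List (Slice Unit)) : HasStates w (resolveWord w) :=
  ⟨Equiv.refl _, fun _ => rfl⟩

theorem hasStates_nil : HasStates [] fun _ : Unit => [] :=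
  ⟨⟨fun _ => (), fun _ p => p.elim0, fun _ => funext fun p => p.elim0, fun _ => rfl⟩,
    fun _ => rfl⟩

/-- Positions split into the first one and the successors, just as `resolveWord` recurses. The
dependent functions on `Fin` are rebuilt here once, so that later bijections use products. -/
theorem HasStates.cons {s : Slice Unit} {w : List (Slice Unit)} {ι κ : Type}
    {φ : ι → List (Slice Empty)} {ψ : κ → List (Slice Empty)}
    (e : (s.event = .vertex () → Replacement) ≃ ι) (he : ∀ g, resolveSlice s g = φ (e g))
    (h : HasStates w ψ) : HasStates (s :: w) fun x : ι × κ => φ x.1 ++ ψ x.2 := by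
  obtain ⟨e', he'⟩ := h
  refine ⟨⟨fun f => (e (f 0), e' fun p => f p.succ),
    fun x => Fin.cons (α := fun p : Fin (s :: w).length =>
      ((s :: w).get p).event = .vertex () → Replacement) (e.symm x.1) (e'.symm x.2),
    fun f => ?_, fun x => ?_⟩, fun f => ?_⟩
  · funext p
    refine Fin.cases ?_ (fun p => ?_) p
    · exact e.symm_apply_apply _
    · exact congrFun (e'.symm_apply_apply fun p => f p.succ) p
  · exact Prod.ext (e.apply_symm_apply x.1) (e'.apply_symm_apply x.2)
  · exact congrArg₂ (· ++ ·) (he (f 0)) (he' fun p => f p.succ)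

theorem HasStates.congr {w : List (Slice Unit)} {ι κ : Type} {φ : ι → List (Slice Empty)}
    {ψ : κ → List (Slice Empty)} (h : HasStates w φ) (e : ι ≃ κ) (he : ∀ x, φ x = ψ (e x)) :
    HasStates w ψ :=
  let ⟨e', he'⟩ := h
  ⟨e'.trans e, fun f => (he' f).trans (he _)⟩

theorem HasStates.append {u v : List (Slice Unit)} {ι κ : Type}
    {φ : ι → List (Slice Empty)} {ψ : κ → List (Slice Empty)} (hu : HasStates u φ)
    (hv : HasStates v ψ) : HasStates (u ++ v) fun x : ι × κ => φ x.1 ++ ψ x.2 := by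
  -- With `φ` replaced by the canonical family of `u`, the induction on `u` needs no hypothesis
  -- about `φ`.
  suffices H : HasStates (u ++ v) fun x : WordAssignment u × κ => resolveWord u x.1 ++ ψ x.2 by
    obtain ⟨e, he⟩ := hu
    exact H.congr (e.prodCongr (Equiv.refl _)) fun x => by simp [he]
  clear hu
  induction u with
  | nil =>
    obtain ⟨e, -⟩ := hasStates_nil
    exact hv.congr ((Equiv.punitProd _).symm.trans (e.symm.prodCongr (Equiv.refl _)))
      fun x => by simp [resolveWord]
  | cons s u ih =>
    obtain ⟨e, he⟩ := HasStates.cons (Equiv.refl _) (fun _ => rfl) (hasStates_self u) (s := s)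
    exact (HasStates.cons (Equiv.refl _) (fun _ => rfl) ih (s := s)).congr
      ((Equiv.prodAssoc _ _ _).symm.trans (e.symm.prodCongr (Equiv.refl _)))
      fun x => by simp [he]

theorem hasStates_vertex (i : ℕ) :
    HasStates [⟨i, .vertex ()⟩] fun r : Replacement => r.word i :=
  (HasStates.cons (s := ⟨i, .vertex ()⟩) (φ := fun r : Replacement => r.word i)
    ⟨fun g => g rfl, fun r _ => r, fun _ => rfl, fun _ => rfl⟩ (fun _ => rfl)
    hasStates_nil).congr (Equiv.prodPUnit _) fun x => by simp

/-- Ordinary events are events of diagrams of `4`-valent tangles. -/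
def Event.toFourValent : Event Empty → Event Unit
  | .cup => .cup
  | .cap => .cap
  | .cross s => .cross s

/-- A word without vertices has only one state. -/
theorem hasStates_ordinary (w : List (Slice Empty)) :
    HasStates (w.map fun s => ⟨s.pos, s.event.toFourValent⟩) fun _ : Unit => w := by
  induction w with
  | nil => exact hasStates_nil
  | cons s w ih =>
    have hs : s.event.toFourValent ≠ .vertex () := by
      obtain ⟨i, e⟩ := s
      cases e with
      | vertex v => exact v.elim
      | _ => exact nofun
    refine (HasStates.cons (s := ⟨s.pos, s.event.toFourValent⟩) (φ := fun _ : Unit => [s])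
      ⟨fun _ => (), fun _ h => (hs h).elim, fun g => funext fun h => (hs h).elim, fun _ => rfl⟩
      (fun g => ?_) ih).congr (Equiv.prodPUnit _) fun x => rfl
    obtain ⟨i, e⟩ := s
    cases e with
    | vertex v => exact v.elim
    | _ => rfl

/-- The states of a single event are blocks. -/
theorem exists_hasStates_event (e : Event Unit) :
    ∃ (ι : Type) (φ : ι → ℕ → List (Slice Empty)),
      (∀ i, HasStates [⟨i, e⟩] fun x => φ x i) ∧ ∀ x, IsBlock e.inputs e.outputs (φ x) := by
  cases e with
  | vertex v => exact ⟨Replacement, fun r i => r.word i, hasStates_vertex, Replacement.isBlock⟩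
  | cup =>
    exact ⟨Unit, fun _ i => [⟨i, .cup⟩], fun i => hasStates_ordinary [⟨i, .cup⟩],
      fun _ => .single .cup⟩
  | cap =>
    exact ⟨Unit, fun _ i => [⟨i, .cap⟩], fun i => hasStates_ordinary [⟨i, .cap⟩],
      fun _ => .single .cap⟩
  | cross s =>
    exact ⟨Unit, fun _ i => [⟨i, .cross s⟩], fun i => hasStates_ordinary [⟨i, .cross s⟩],
      fun _ => .single (.cross s)⟩

/-! ### Lifting the moves to bijections of states -/

/-- The states of two words correspond to each other bijectively, up to `3`-equivalence. -/
def StatesEquiv (m n : ℕ) (a b : List (Slice Unit)) : Prop :=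
  ∃ e : WordAssignment a ≃ WordAssignment b,
    ∀ f, WordEquiv m n (resolveWord a f) (resolveWord b (e f))

theorem StatesEquiv.of_hasStates {m n : ℕ} {a b : List (Slice Unit)} {ι κ : Type}
    {φ : ι → List (Slice Empty)} {ψ : κ → List (Slice Empty)} (ha : HasStates a φ)
    (hb : HasStates b ψ) (e : ι ≃ κ) (he : ∀ x, WordEquiv m n (φ x) (ψ (e x))) :
    StatesEquiv m n a b := by
  obtain ⟨e₁, h₁⟩ := ha
  obtain ⟨e₂, h₂⟩ := hb
  refine ⟨(e₁.trans e).trans e₂.symm, fun f => ?_⟩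
  rw [h₁, h₂]
  simpa using he (e₁ f)

/-- The bijection is the identity on the vertices of `u` and `v`. -/
theorem StatesEquiv.context {m n p q : ℕ} {u a b v : List (Slice Unit)} (hu : IsWord m u p)
    (h : StatesEquiv p q a b) (hv : IsWord q v n) :
    StatesEquiv m n (u ++ a ++ v) (u ++ b ++ v) := by
  obtain ⟨e, he⟩ := h
  exact .of_hasStates (((hasStates_self u).append (hasStates_self a)).append (hasStates_self v))
    (((hasStates_self u).append (hasStates_self b)).append (hasStates_self v))
    (((Equiv.refl _).prodCongr e).prodCongr (Equiv.refl _))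
    fun x => .context (isWord_resolveWord p u m _ hu) (he _) (isWord_resolveWord n v q _ hv)

/-- A change of words without vertices. -/
theorem StatesEquiv.of_ordinary {m n : ℕ} (a b : List (Slice Empty))
    (h : PlanarMove Empty a b ∨ ReidemeisterMove Empty a b)
    (ha : IsWord m (a.map fun s => (⟨s.pos, s.event.toFourValent⟩ : Slice Unit)) n)
    (hb : IsWord m (b.map fun s => (⟨s.pos, s.event.toFourValent⟩ : Slice Unit)) n) :
    StatesEquiv m n (a.map fun s => ⟨s.pos, s.event.toFourValent⟩)
      (b.map fun s => ⟨s.pos, s.event.toFourValent⟩) := by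
  -- The ordinary word is the only state of its image, and states inherit `IsWord`.
  have key : ∀ w : List (Slice Empty),
      IsWord m (w.map fun s => (⟨s.pos, s.event.toFourValent⟩ : Slice Unit)) n →
        IsWord m w n := by
    intro w hw
    obtain ⟨e, he⟩ := hasStates_ordinary w
    have := isWord_resolveWord n _ m (e.symm ()) hw
    rwa [he] at this
  refine .of_hasStates (hasStates_ordinary a) (hasStates_ordinary b) (Equiv.refl _) fun _ => ?_
  have h' : PlanarMove Empty a b ∨ ReidemeisterMove Empty a b ∨ ThreeMove Empty a b :=
    h.elim .inl fun h => .inr (.inl h)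
  simpa using WordEquiv.of_move (m := m) (n := n) [] [] h' (by simpa using key a ha)
    (by simpa using key b hb)

/-- Either event may be a vertex; since all states of an event are blocks, one block exchange covers
every case, with the two indices swapped. -/
theorem statesEquiv_exchange {m n : ℕ} (i k : ℕ) (e f : Event Unit)
    (ha : IsWord m [⟨i, e⟩, ⟨i + e.outputs + k, f⟩] n) :
    StatesEquiv m n [⟨i, e⟩, ⟨i + e.outputs + k, f⟩] [⟨i + e.inputs + k, f⟩, ⟨i, e⟩] := by
  obtain ⟨ι, φ, hφ, hφ'⟩ := exists_hasStates_event e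
  obtain ⟨κ, ψ, hψ, hψ'⟩ := exists_hasStates_event f
  simp only [IsWord] at ha
  exact .of_hasStates ((hφ i).append (hψ _)) ((hψ _).append (hφ i)) (Equiv.prodComm _ _)
    fun x => (hφ' x.1).exchange (hψ' x.2) (by omega) (by omega)

theorem statesEquiv_planarMove {m n : ℕ} {a b : List (Slice Unit)} (h : PlanarMove Unit a b)
    (ha : IsWord m a n) (hb : IsWord m b n) : StatesEquiv m n a b := by
  cases h with
  | exchange i k e f => exact statesEquiv_exchange i k e f ha
  -- A concrete vertex-free word is definitionally the image of an ordinary one, so `ha` and `hb`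
  -- apply directly.
  | zigzag i => exact .of_ordinary _ _ (.inl (.zigzag i)) ha hb
  | zigzag' i => exact .of_ordinary _ _ (.inl (.zigzag' i)) ha hb
  | turnCross s i => exact .of_ordinary _ _ (.inl (.turnCross s i)) ha hb
  | turnVertex v i =>
    obtain ⟨hi, rfl⟩ : i + 2 ≤ m ∧ m = n := by
      simp only [IsWord, Event.inputs, Event.outputs] at hb
      omega
    exact .of_hasStates (((hasStates_ordinary [⟨i + 2, .cup⟩]).append
      (hasStates_vertex (i + 1))).append (hasStates_ordinary [⟨i, .cap⟩])) (hasStates_vertex i)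
      (((Equiv.prodPUnit _).trans (Equiv.punitProd _)).trans Replacement.turn_involutive.toPerm)
      fun x => wordEquiv_turn_replacement x.1.2 hi

theorem statesEquiv_reidemeisterMove {m n : ℕ} {a b : List (Slice Unit)}
    (h : ReidemeisterMove Unit a b) (ha : IsWord m a n) (hb : IsWord m b n) :
    StatesEquiv m n a b := by
  cases h with
  | R1_cap s i => exact .of_ordinary _ _ (.inr (.R1_cap s i)) ha hb
  | R1_cup s i => exact .of_ordinary _ _ (.inr (.R1_cup s i)) ha hb
  | R2 s i => exact .of_ordinary _ _ (.inr (.R2 s i)) ha hb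
  | R3 s i => exact .of_ordinary _ _ (.inr (.R3 s i)) ha hb

theorem statesEquiv_vertexMove {m n : ℕ} {a b : List (Slice Unit)} (h : VertexMove Unit a b)
    (hb : IsWord m b n) : StatesEquiv m n a b := by
  cases h with
  | N4 v s i =>
    obtain ⟨hi, rfl⟩ : i + 3 ≤ m ∧ m = n := by
      simp only [IsWord, Event.inputs, Event.outputs] at hb
      omega
    exact .of_hasStates
      ((hasStates_vertex (i + 1)).append (hasStates_ordinary [⟨i, .cross s⟩, ⟨i + 1, .cross s⟩]))
      ((hasStates_ordinary [⟨i, .cross s⟩, ⟨i + 1, .cross s⟩]).append (hasStates_vertex i))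
      (Equiv.prodComm _ _) fun x => wordEquiv_slide_replacement s x.1 hi
  | N5 v s i =>
    obtain ⟨hi, rfl⟩ : i + 2 ≤ m ∧ m = n := by
      simp only [IsWord, Event.inputs, Event.outputs] at hb
      omega
    exact .of_hasStates ((hasStates_vertex i).append (hasStates_ordinary [⟨i, .cross s⟩]))
      (hasStates_vertex i)
      ((Equiv.prodPUnit _).trans ⟨Replacement.twist s, Replacement.twist (!s),
        Replacement.twist_not_twist s, fun r => by
          simpa using Replacement.twist_not_twist (!s) r⟩)
      fun x => wordEquiv_twist_replacement s x.1 hi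

/-! ### States of isotopic diagrams -/

/-- An assignment for a diagram is an assignment for its word. -/
def Diagram.assignmentEquiv {k l : ℕ} (D : FourValentDiagram k l) :
    D.Assignment ≃ WordAssignment D.word :=
  ⟨fun f p hp => f ⟨p, hp⟩, fun g x => g x.1 x.2, fun _ => rfl, fun _ => rfl⟩

theorem LocalChange.exists_equiv_state {k l : ℕ} {D D' : FourValentDiagram k l}
    (h : LocalChange
      (fun a b => PlanarMove Unit a b ∨ ReidemeisterMove Unit a b ∨ VertexMove Unit a b) D D') :
    ∃ e : D.Assignment ≃ D'.Assignment,
      ∀ f, ThreeEquivalent (D.state f) (D'.state (e f)) := by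
  obtain ⟨u, a, b, v, h, h₁, h₂⟩ := h
  have hw := D.isWord
  have hw' := D'.isWord
  rw [h₁, List.append_assoc, isWord_append] at hw
  rw [h₂] at hw'
  obtain ⟨q', hub, hv'⟩ := isWord_append.1 hw'
  obtain ⟨p', hu', hb⟩ := isWord_append.1 hub
  obtain ⟨p, hu, hw⟩ := hw
  obtain ⟨q, ha, hv⟩ := isWord_append.1 hw
  -- The common words `u` and `v` force both local words to run between the same strand counts.
  obtain rfl := hv.bottom_unique hv'
  obtain rfl := hu.top_unique hu'
  have key : StatesEquiv p q a b := by
    rcases h with h | h | h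
    · exact statesEquiv_planarMove h ha hb
    · exact statesEquiv_reidemeisterMove h ha hb
    · exact statesEquiv_vertexMove h hb
  have key' : StatesEquiv k l D.word D'.word := by
    rw [h₁, h₂]
    exact key.context hu hv
  obtain ⟨e, he⟩ := key'
  refine ⟨(D.assignmentEquiv.trans e).trans D'.assignmentEquiv.symm, fun f => ?_⟩
  obtain ⟨_, _, h⟩ := he (D.assignmentEquiv f)
  exact h

/-- The states of ambient isotopic diagrams correspond to each other bijectively, up to
`3`-equivalence. -/
theorem AmbientIsotopic.exists_equiv_state {k l : ℕ} {D D' : FourValentDiagram k l}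
    (h : AmbientIsotopic D D') :
    ∃ e : D.Assignment ≃ D'.Assignment,
      ∀ f, ThreeEquivalent (D.state f) (D'.state (e f)) := by
  induction h with
  | rel D D' h => exact LocalChange.exists_equiv_state h
  | refl D => exact ⟨Equiv.refl _, fun _ => .refl _⟩
  | symm D D' _ ih =>
    obtain ⟨e, he⟩ := ih
    exact ⟨e.symm, fun f => .symm _ _ (by simpa [ThreeEquivalent] using he (e.symm f))⟩
  | trans D D' D'' _ _ ih ih' =>
    obtain ⟨e, he⟩ := ih
    obtain ⟨e', he'⟩ := ih'
    exact ⟨e.trans e', fun f => .trans _ _ _ (he f) (he' (e f))⟩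

/-! ### Counting assignments -/

theorem card_replacement : Nat.card Replacement = 4 := by
  let e : Replacement ≃ Fin 4 :=
    ⟨fun | .Tminus => 0 | .Tplus => 1 | .Tzero => 2 | .Tinfty => 3,
      fun | 0 => .Tminus | 1 => .Tplus | 2 => .Tzero | 3 => .Tinfty,
      fun r => by cases r <;> rfl, fun j => by fin_cases j <;> rfl⟩
  rw [Nat.card_congr e, Nat.card_fin]

theorem Diagram.card_assignment {k l : ℕ} (D : FourValentDiagram k l) :
    Nat.card D.Assignment = 4 ^ Nat.card D.Vertex := by
  have : Finite D.Vertex := Subtype.finite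
  rw [Nat.card_fun, card_replacement]

end SpatialGraph

theorem mainTheorem3 (k l n : ℕ) (D D' : SpatialGraph.FourValentDiagram k l)
    (h : SpatialGraph.AmbientIsotopic D D') (hn : Nat.card D.Vertex = n) :
    Nat.card D'.Vertex = n ∧
    Nat.card D.Assignment = 4 ^ n ∧
    Nat.card D'.Assignment = 4 ^ n ∧
    (∀ (f : Fin (4 ^ n) ≃ D.Assignment) (f' : Fin (4 ^ n) ≃ D'.Assignment),
      ∃ σ : Equiv.Perm (Fin (4 ^ n)),
        ∀ i : Fin (4 ^ n), SpatialGraph.ThreeEquivalent (D.state (f i)) (D'.state (f' (σ i)))) ∧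
    SpatialGraph.CollectionThreeEquivalent D.stateCollection D'.stateCollection ∧
    SpatialGraph.CollectionThreeEquivalent D'.stateCollection D.stateCollection := by
  obtain ⟨e, he⟩ := h.exists_equiv_state
  have h₁ : Nat.card D.Assignment = 4 ^ n := by rw [D.card_assignment, hn]
  have h₂ : Nat.card D'.Assignment = 4 ^ n := by rw [← Nat.card_congr e, h₁]
  refine ⟨?_, h₁, h₂, fun f f' => ⟨(f.trans e).trans f'.symm, fun i => ?_⟩, ?_, ?_⟩
  -- The bijection concerns assignments, not vertices; the number of vertices is recovered because
  -- `4 ^ ·` is injective.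
  · rw [D'.card_assignment] at h₂
    exact Nat.pow_right_injective (le_refl 2 |>.trans (by norm_num)) h₂
  · simpa using he (f i)
  · rintro _ ⟨f, rfl⟩
    exact ⟨_, ⟨e f, rfl⟩, he f⟩
  · rintro _ ⟨f, rfl⟩
    exact ⟨_, ⟨e.symm f, rfl⟩, .symm _ _ (by simpa [SpatialGraph.ThreeEquivalent] using he (e.symm f))⟩
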